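/- Let $k$ be a field, $S=k[x_1,\ldots,x_n]$ with $n\ge 1$, and $d\ge 2$. Let $>_{lex}$ be the lexicographic order on monomials with $x_1>x_2>\cdots>x_n$. Let $u,v$ be monomials of degree $d$ with $u\ge_{lex}v$, and let $\mathcal L(u,v)$ be the set of monomials $w$ of degree $d$ with $u\ge_{lex}w\ge_{lex}v$ (such a set is called a lexsegment). Assume that $\mathcal L(u,v)$ is a completely lexsegment, that is, all its iterated shadows are lexsegments, where the shadow of a set $T$ of monomials is $\{m x_i\mid m\in T,\ 1\le i\le n\}$. Let $I=(\mathcal L(u,v))$, and assume that $I$ has a ($d$-)linear resolution, that is, a graded free resolution $\cdots\to S(-d-2)^{\beta_2}\to S(-d-1)^{\beta_1}\to S(-d)^{\beta_0}\to I\to 0$ with all $\beta_i$ finite. For monomials $w=x_1^{\alpha_1}\cdots x_n^{\alpha_n}$ and $w'=x_1^{\gamma_1}\cdots x_n^{\gamma_n}$ of degree $d$, put $w\prec w'$ if $\alpha_1<\gamma_1$, or $\alpha_1=\gamma_1$ and $w>_{lex}w'$. Let $G(I)=\{w_1,\ldots,w_r\}$ be the set of minimal monomial generators of $I$, numbered so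 that $w_1\prec w_2\prec\cdots\prec w_r$. Then $I$ has linear quotients with respect to $w_1,\ldots,w_r$, that is, for $2\le j\le r$ the ideal $(w_1,\ldots,w_{j-1}):w_j$ is generated by a subset of $\{x_1,\ldots,x_n\}$; and the decomposition function of $I$ with respect to $w_1,\ldots,w_r$ is regular. The latter means the following. For $1\le j\le r$ let $\mathrm{set}(w_j)=\{i\mid x_i\in(w_1,\ldots,w_{j-1}):w_j\}$, and for a monomial $m\in I$ let $g(m)=w_j$ for the smallest $j$ such that $m\in(w_1,\ldots,w_j)$. Then $$\mathrm{set}(g(x_sw))\subseteq\mathrm{set}(w)\qquad\text{for all } w\in G(I)\text{ and all } s\in\mathrm{set}(w).$$ -/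

import Mathlib

open MvPolynomial

noncomputable section

namespace LexsegIdeal

/- A monomial `x_1^{a_1} ⋯ x_n^{a_n}` of `S = k[x_1, …, x_n]` is represented by its exponent vector
`a : Fin n →₀ ℕ`; the variable `x_1` has index `0`. Multiplication of monomials is addition of
exponent vectors, and divisibility is the pointwise order. -/

/-- `a ≥_lex b` for monomials of the same degree, with `x_1 > x_2 > ⋯ > x_n`: either `a = b`, or at
the first index where `a` and `b` differ, `a` has the larger exponent. -/
def LexGE {n : ℕ} (a b : Fin n →₀ ℕ) : Prop := toLex b ≤ toLex a

/-- The strict version `a >_lex b`. -/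
def LexGT {n : ℕ} (a b : Fin n →₀ ℕ) : Prop := toLex b < toLex a

/-- The set `L(u, v)` of monomials `w` of degree `d` with `u ≥_lex w ≥_lex v`. -/
def lexsegment {n : ℕ} (d : ℕ) (u v : Fin n →₀ ℕ) : Set (Fin n →₀ ℕ) :=
  {w | w.degree = d ∧ LexGE u w ∧ LexGE w v}

/-- A set of monomials is a lexsegment if it is `L(u, v)` for some monomials `u ≥_lex v` of the same
degree. -/
def IsLexsegment {n : ℕ} (T : Set (Fin n →₀ ℕ)) : Prop :=
  ∃ (d : ℕ) (u v : Fin n →₀ ℕ),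
    u.degree = d ∧ v.degree = d ∧ LexGE u v ∧ T = lexsegment d u v

/-- The shadow `{m x_i | m ∈ T, 1 ≤ i ≤ n}`. -/
def shadow {n : ℕ} (T : Set (Fin n →₀ ℕ)) : Set (Fin n →₀ ℕ) :=
  {a | ∃ m ∈ T, ∃ i : Fin n, a = m + Finsupp.single i 1}

/-- All iterated shadows (the zeroth being the set itself) are lexsegments. -/
def IsCompletelyLexsegment {n : ℕ} (T : Set (Fin n →₀ ℕ)) : Prop :=
  ∀ i : ℕ, IsLexsegment (shadow^[i] T)

/-- The ideal of `k[x_1, …, x_n]` generated by a set of monomials. -/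
def monomialIdeal (k : Type*) [Field k] {n : ℕ} (T : Set (Fin n →₀ ℕ)) :
    Ideal (MvPolynomial (Fin n) k) :=
  Ideal.span ((fun a => monomial a (1 : k)) '' T)

/-- `G(I)`: the monomials of `I` that are minimal with respect to divisibility. -/
def minimalGenerators {k : Type*} [Field k] {n : ℕ} (I : Ideal (MvPolynomial (Fin n) k)) :
    Set (Fin n →₀ ℕ) :=
  {a | Minimal (fun b => monomial b (1 : k) ∈ I) a}

/-- `I` has a `d`-linear resolution: there is an exact sequence
`⋯ → S(-d-2)^{β 2} → S(-d-1)^{β 1} → S(-d)^{β 0} → I → 0`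
of graded modules and maps of degree zero. The map onto `I` is given by forms `f j` of degree `d`
generating `I`, and the map from step `i + 1` to step `i` by a matrix `D i` all of whose entries are
linear forms (zero included). -/
def HasLinearResolution {k : Type*} [Field k] {n : ℕ} (d : ℕ)
    (I : Ideal (MvPolynomial (Fin n) k)) : Prop :=
  ∃ (β : ℕ → ℕ) (f : Fin (β 0) → MvPolynomial (Fin n) k)
    (D : ∀ i : ℕ, Matrix (Fin (β i)) (Fin (β (i + 1))) (MvPolynomial (Fin n) k)),
    (∀ j, (f j).IsHomogeneous d) ∧
    Ideal.span (Set.range f) = I ∧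
    (∀ i p q, (D i p q).IsHomogeneous 1) ∧
    Function.Exact (D 0).mulVecLin (Fintype.linearCombination (MvPolynomial (Fin n) k) f) ∧
    ∀ i, Function.Exact (D (i + 1)).mulVecLin (D i).mulVecLin

/-- The order `≺`: `a ≺ b` if the exponent of `x_1` is smaller in `a` than in `b`, or the two
exponents agree and `a >_lex b`. -/
def Prec {n : ℕ} [NeZero n] (a b : Fin n →₀ ℕ) : Prop :=
  a 0 < b 0 ∨ (a 0 = b 0 ∧ LexGT a b)

section Quotients

/- Below, `w : Fin r → (Fin n →₀ ℕ)` is a finite sequence of monomials `w_1, …, w_r`, in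
applications the minimal generators of a monomial ideal `I = (w_1, …, w_r)` in some order. -/

/-- The colon ideal `(w_1, …, w_{j-1}) : w_j`. -/
def colonIdeal (k : Type*) [Field k] {n r : ℕ} (w : Fin r → (Fin n →₀ ℕ)) (j : Fin r) :
    Ideal (MvPolynomial (Fin n) k) :=
  (monomialIdeal k (w '' Set.Iio j)).colon {monomial (w j) (1 : k)}

/-- Each colon ideal `(w_1, …, w_{j-1}) : w_j`, for `j` not the first index, is generated by a
subset of the variables. -/
def HasLinearQuotients (k : Type*) [Field k] {n r : ℕ} (w : Fin r → (Fin n →₀ ℕ)) : Prop :=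
  ∀ j : Fin r, 0 < (j : ℕ) →
    ∃ A : Set (Fin n), colonIdeal k w j = Ideal.span ((fun i => (X i : MvPolynomial (Fin n) k)) '' A)

/-- `set(w_j)`, the set of all `i` with `x_i ∈ (w_1, …, w_{j-1}) : w_j`. -/
def genSet (k : Type*) [Field k] {n r : ℕ} (w : Fin r → (Fin n →₀ ℕ)) (j : Fin r) :
    Set (Fin n) :=
  {i | (X i : MvPolynomial (Fin n) k) ∈ colonIdeal k w j}

/-- `M(I)`: the monomials in the ideal `I = (w_1, …, w_r)`. -/
def monomialsOf (k : Type*) [Field k] {n r : ℕ} (w : Fin r → (Fin n →₀ ℕ)) :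
    Set (Fin n →₀ ℕ) :=
  {a | monomial a (1 : k) ∈ monomialIdeal k (Set.range w)}

/-- A multiple of a generator by a variable is a monomial of the ideal. -/
theorem single_add_mem_monomialsOf (k : Type*) [Field k] {n r : ℕ} (w : Fin r → (Fin n →₀ ℕ))
    (s : Fin n) (j : Fin r) : Finsupp.single s 1 + w j ∈ monomialsOf k w := by
  have h : monomial (w j) (1 : k) ∈ monomialIdeal k (Set.range w) :=
    Ideal.subset_span ⟨w j, ⟨j, rfl⟩, rfl⟩
  have h2 := Ideal.mul_mem_left _ (monomial (Finsupp.single s 1) (1 : k)) h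
  rw [monomial_mul, one_mul] at h2
  exact h2

/-- Every monomial of `I` lies in some `I_j = (w_1, …, w_j)`. -/
theorem exists_mem_of_mem_monomialsOf (k : Type*) [Field k] {n r : ℕ} (w : Fin r → (Fin n →₀ ℕ))
    (a : monomialsOf k w) :
    {j : Fin r | monomial a.1 (1 : k) ∈ monomialIdeal k (w '' Set.Iic j)}.Nonempty := by
  have h := a.2
  simp only [monomialsOf, monomialIdeal, Set.mem_ofPred_eq] at h
  rw [mem_ideal_span_monomial_image] at h
  obtain ⟨b, ⟨j, rfl⟩, hb⟩ := h a.1 (by simp)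
  refine ⟨j, ?_⟩
  simp only [monomialIdeal, Set.mem_ofPred_eq]
  rw [mem_ideal_span_monomial_image]
  intro c hc
  have hc' : c = a.1 := by
    have := support_monomial_subset hc
    simpa using this
  exact ⟨w j, ⟨j, le_refl j, rfl⟩, hc' ▸ hb⟩

/-- The decomposition function `g : M(I) → G(I)` with respect to `w_1, …, w_r`. Its value at `a` is
given as an index: `g(a) = w_j` for the smallest `j` with `a ∈ (w_1, …, w_j)`. -/
def decompositionFunction (k : Type*) [Field k] {n r : ℕ} (w : Fin r → (Fin n →₀ ℕ))
    (a : monomialsOf k w) : Fin r :=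
  WellFounded.min (wellFounded_lt (α := Fin r))
    {j : Fin r | monomial a.1 (1 : k) ∈ monomialIdeal k (w '' Set.Iic j)}
    (exists_mem_of_mem_monomialsOf k w a)

/-- The decomposition function is regular: `set(g(x_s w_j)) ⊆ set(w_j)` for all generators `w_j` and
all `s ∈ set(w_j)`. -/
def HasRegularDecomposition (k : Type*) [Field k] {n r : ℕ} (w : Fin r → (Fin n →₀ ℕ)) : Prop :=
  ∀ (j : Fin r), ∀ s ∈ genSet k w j,
    genSet k w (decompositionFunction k w
      ⟨Finsupp.single s 1 + w j, single_add_mem_monomialsOf k w s j⟩) ⊆ genSet k w j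

end Quotients

end LexsegIdeal

end

/-! Index the variables from 0 and put `T = L(u, v)`. Both conclusions follow from one exchange
property, `IsExchangeable`: if `m ∈ T`, `0 < i < j` and `x_j ∣ m`, then `x_i m / x_j ∈ T` or `x_i m
/ x_0 ∈ T`.

To prove it, put `Y = x_i m / x_j`, which is lex-above `m ≥ v`; only `Y > u` needs work. As the
first shadow of `T` is a lexsegment, it contains every `x_l Y` with `l ≠ 0`. If `x_0 ∤ Y`, this
already forces `Y ≤ u`. If `Y = x_0 q`, let `e` be the Koszul basis element of all variables but
`x_0`. The boundary of `Y e` is a cycle with coefficients in `I` of degree `d + 1`. A linear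
resolution makes it the boundary of a chain with coefficients in `I`
(`HasLinearResolution.exists_diff_eq`), and comparing one coefficient gives `x_j q = x_i m / x_0 ∈
T` (`HasLinearResolution.single_add_mem`).

The rest is combinatorics of exponents: `exists_mem_exchangeSet` yields linear quotients and
`exchangeSet_subset` yields regularity. Besides the exchange property they use only that `T` is
lex-convex. -/

namespace Koszul

/-! ### The Koszul differential. -/

variable {ι : Type*} [LinearOrder ι]

/-- The sign `(-1)^a`, where `a` is the number of elements of `σ` below `s`. -/
def sign (R : Type*) [CommRing R] (s : ι) (σ : Finset ι) : R :=
  (-1) ^ (σ.filter (· < s)).card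

theorem sign_mul_self {R : Type*} [CommRing R] (s : ι) (σ : Finset ι) :
    sign R s σ * sign R s σ = 1 := by
  rw [sign, ← pow_add, ← two_mul, pow_mul]
  simp

theorem sign_anticomm {R : Type*} [CommRing R] {r s : ι} {σ : Finset ι} (hrs : r ≠ s)
    (hr : r ∉ σ) (hs : s ∉ σ) :
    sign R r σ * sign R s (insert r σ) = -(sign R s σ * sign R r (insert s σ)) := by
  wlog h : r < s generalizing r s
  · rw [this hrs.symm hs hr (lt_of_le_of_ne (not_lt.mp h) hrs.symm), neg_neg]
  · have h1 : (insert r σ).filter (· < s) = insert r (σ.filter (· < s)) := by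
      rw [Finset.filter_insert, if_pos h]
    have h2 : (insert s σ).filter (· < r) = σ.filter (· < r) := by
      rw [Finset.filter_insert, if_neg h.not_gt]
    rw [sign, sign, sign, sign, h1, h2, Finset.card_insert_of_notMem (by simp [hr])]
    ring

theorem sign_eq_C {R : Type*} [CommRing R] (s : ι) (σ : Finset ι) :
    sign (MvPolynomial ι R) s σ = C (sign R s σ) := by
  simp [sign]

theorem isHomogeneous_sign_mul_X {R : Type*} [CommRing R] (s : ι) (σ : Finset ι) :
    (sign (MvPolynomial ι R) s σ * X s).IsHomogeneous 1 := by
  rw [sign_eq_C]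
  exact isHomogeneous_C_mul_X _ s

variable [Fintype ι] {R : Type*} [CommRing R] {V W : Type*} [AddCommGroup V] [Module R V]
  [AddCommGroup W] [Module R W]

/-- The differential of the Koszul complex of the sequence `x` with coefficients in `V`. A chain
`∑ c σ e_σ` is represented by the function `c`. -/
def diff (x : ι → R) (c : Finset ι → V) (σ : Finset ι) : V :=
  ∑ s ∈ σᶜ, (sign R s σ * x s) • c (insert s σ)

theorem diff_diff (x : ι → R) (c : Finset ι → V) (σ : Finset ι) : diff x (diff x c) σ = 0 := by
  simp only [diff, Finset.smul_sum, smul_smul]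
  rw [Finset.sum_sigma']
  have hmem : ∀ p : (_ : ι) × ι, p ∈ (σᶜ.sigma fun s => (insert s σ)ᶜ) ↔
      p.1 ∉ σ ∧ p.2 ≠ p.1 ∧ p.2 ∉ σ := by
    intro p
    simp [Finset.mem_sigma]
  -- Removing `s` and `r` in either order gives the same term with opposite signs.
  refine Finset.sum_involution (fun p _ => ⟨p.2, p.1⟩) ?_ ?_ ?_ ?_
  · rintro ⟨s, r⟩ hp
    obtain ⟨hs, hrs, hr⟩ := (hmem _).1 hp
    dsimp only at *
    rw [Finset.insert_comm s r σ, ← add_smul]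
    have := sign_anticomm (R := R) hrs hr hs
    rw [show sign R s σ * x s * (sign R r (insert s σ) * x r)
        + sign R r σ * x r * (sign R s (insert r σ) * x s)
        = (sign R s σ * sign R r (insert s σ) + sign R r σ * sign R s (insert r σ)) * (x s * x r)
        by ring, this]
    simp
  · rintro ⟨s, r⟩ hp _ h
    obtain ⟨hs, hrs, hr⟩ := (hmem _).1 hp
    simp only [Sigma.mk.injEq, heq_eq_eq] at h
    exact hrs h.1
  · rintro ⟨s, r⟩ hp
    obtain ⟨hs, hrs, hr⟩ := (hmem _).1 hp
    exact (hmem _).2 ⟨hr, hrs.symm, hs⟩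
  · rintro ⟨s, r⟩ hp
    rfl

theorem map_diff (x : ι → R) (φ : V →ₗ[R] W) (c : Finset ι → V) (σ : Finset ι) :
    φ (diff x c σ) = diff x (fun τ => φ (c τ)) σ := by
  simp [diff, map_sum, map_smul]

theorem diff_sub (x : ι → R) (c c' : Finset ι → V) (σ : Finset ι) :
    diff x (fun τ => c τ - c' τ) σ = diff x c σ - diff x c' σ := by
  simp [diff, smul_sub, Finset.sum_sub_distrib]

theorem diff_eq_zero_of_card {x : ι → R} {c : Finset ι → V} {N : ℕ}
    (hc : ∀ σ, N + 1 ≤ σ.card → c σ = 0) (σ : Finset ι) (hσ : N ≤ σ.card) : diff x c σ = 0 := by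
  refine Finset.sum_eq_zero fun s hs => ?_
  rw [hc, smul_zero]
  rw [Finset.card_insert_of_notMem (by simpa using hs)]
  omega

end Koszul

/-! ### Linear forms and graded components. -/

namespace MvPolynomial.IsHomogeneous

variable {σ R : Type*} [CommRing R]

theorem eq_single_of_coeff_ne_zero {p : MvPolynomial σ R} (hp : p.IsHomogeneous 1)
    {m : σ →₀ ℕ} (hm : coeff m p ≠ 0) : ∃ s, m = Finsupp.single s 1 := by
  have h : m.degree = 1 := by
    rw [Finsupp.degree_eq_weight_one]
    exact hp hm
  have hne : m ≠ 0 := by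
    rintro rfl
    simp at h
  obtain ⟨s, hs⟩ := Finsupp.support_nonempty_iff.2 hne
  have hle : Finsupp.single s 1 ≤ m := by
    rw [Finsupp.single_le_iff]
    exact Nat.one_le_iff_ne_zero.2 (Finsupp.mem_support_iff.1 hs)
  obtain ⟨m', rfl⟩ := exists_add_of_le hle
  rw [map_add, Finsupp.degree_single] at h
  have h0 : m' = 0 := (Finsupp.degree_eq_zero_iff m').1 (by omega)
  exact ⟨s, by rw [h0, add_zero]⟩

theorem ext_of_coeff_single {p q : MvPolynomial σ R} (hp : p.IsHomogeneous 1)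
    (hq : q.IsHomogeneous 1)
    (h : ∀ s, coeff (Finsupp.single s 1) p = coeff (Finsupp.single s 1) q) : p = q := by
  rw [← sub_eq_zero]
  ext m
  by_contra hm
  obtain ⟨s, rfl⟩ := (hp.sub hq).eq_single_of_coeff_ne_zero hm
  exact hm (by simp [h s])

/-- Lets a preimage under a homogeneous map be replaced by its component of the right degree. -/
theorem homogeneousComponent_mul {p : MvPolynomial σ R} {a : ℕ} (hp : p.IsHomogeneous a) (m : ℕ)
    (q : MvPolynomial σ R) :
    homogeneousComponent (a + m) (p * q) = p * homogeneousComponent m q := by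
  conv_lhs => rw [← sum_homogeneousComponent q, Finset.mul_sum, map_sum]
  have h : ∀ i, homogeneousComponent (a + m) (p * homogeneousComponent i q) =
      if i = m then p * homogeneousComponent m q else 0 := by
    intro i
    rw [homogeneousComponent_of_mem (hp.mul (homogeneousComponent_isHomogeneous i q))]
    by_cases him : i = m
    · simp [him]
    · rw [if_neg (by omega), if_neg him]
  rw [Finset.sum_congr rfl fun i _ => h i, Finset.sum_ite_eq']
  split_ifs with hm
  · rfl
  · rw [homogeneousComponent_eq_zero _ _ (by simpa using hm), mul_zero]

end MvPolynomial.IsHomogeneous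

/-! ### Koszul cycles with linear coefficients. -/

namespace Koszul

variable {ι : Type*} [LinearOrder ι] [Fintype ι] {R : Type*} [CommRing R]

theorem coeff_diff (c : Finset ι → MvPolynomial ι R) (σ : Finset ι) (m : ι →₀ ℕ) :
    coeff m (diff (X : ι → MvPolynomial ι R) c σ) =
      ∑ s ∈ σᶜ, sign R s σ *
        (if s ∈ m.support then coeff (m - Finsupp.single s 1) (c (insert s σ)) else 0) := by
  rw [diff, coeff_sum]
  refine Finset.sum_congr rfl fun s _ => ?_
  rw [smul_eq_mul, mul_assoc, sign_eq_C, coeff_C_mul, coeff_X_mul']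

/-- A Koszul cycle whose coefficients are linear forms is the boundary of a chain with constant
coefficients. -/
theorem exists_constant_of_diff_eq_zero {c : Finset ι → MvPolynomial ι R}
    (hc : ∀ σ, (c σ).IsHomogeneous 1) (h : ∀ σ, diff (X : ι → MvPolynomial ι R) c σ = 0) :
    ∃ b : Finset ι → R, ∀ σ, diff (X : ι → MvPolynomial ι R) (fun τ => C (b τ)) σ = c σ := by
  classical
  let γ : ι → Finset ι → R := fun s σ => coeff (Finsupp.single s 1) (c σ)
  have hγ : ∀ s σ, γ s σ = coeff (Finsupp.single s 1) (c σ) := fun _ _ => rfl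
  -- In the boundary at `ρ \ {s}`, only the summand that inserts `s` can contribute to `x_r x_s`.
  have hmem : ∀ ρ, ∀ s ∈ ρ, ∀ r ∈ ρ, γ r ρ = 0 := by
    intro ρ s hs r hr
    have hins : insert s (ρ.erase s) = ρ := Finset.insert_erase hs
    have h1 := congrArg (coeff (Finsupp.single r 1 + Finsupp.single s 1)) (h (ρ.erase s))
    rw [coeff_diff, coeff_zero, Finset.sum_eq_single s] at h1
    · rw [if_pos (by simp), add_tsub_cancel_right, hins, ← hγ] at h1
      have := congrArg (fun z => sign R s (ρ.erase s) * z) h1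
      simpa [← mul_assoc, sign_mul_self] using this
    · intro t ht hts
      rw [if_neg, mul_zero]
      have htr : t ≠ r := by
        rintro rfl
        simp [hts, hr] at ht
      simp [htr.symm, hts.symm]
    · intro hs'
      simp at hs'
  have hanti : ∀ σ r s, r ≠ s → r ∉ σ → s ∉ σ →
      sign R r σ * γ s (insert r σ) + sign R s σ * γ r (insert s σ) = 0 := by
    intro σ r s hrs hr hs
    have h1 := congrArg (coeff (Finsupp.single r 1 + Finsupp.single s 1)) (h σ)
    rw [coeff_diff, coeff_zero,
      Finset.sum_eq_add_of_mem r s (by simpa using hr) (by simpa using hs) hrs] at h1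
    · rw [if_pos (by simp), if_pos (by simp), add_tsub_cancel_right, add_tsub_cancel_left] at h1
      exact h1
    · rintro t - ⟨htr, hts⟩
      rw [if_neg, mul_zero]
      simp [htr.symm, hts.symm]
  have hindep : ∀ (ρ : Finset ι) (r s : ι), r ∈ ρ → s ∈ ρ →
      sign R r (ρ.erase r) * γ r (ρ.erase r) = sign R s (ρ.erase s) * γ s (ρ.erase s) := by
    intro ρ r s hr hs
    by_cases hrs : r = s
    · rw [hrs]
    have hr' : r ∉ (ρ.erase r).erase s := by simp
    have hs' : s ∉ (ρ.erase r).erase s := by simp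
    have e1 : insert s ((ρ.erase r).erase s) = ρ.erase r :=
      Finset.insert_erase (Finset.mem_erase.2 ⟨Ne.symm hrs, hs⟩)
    have e2 : insert r ((ρ.erase r).erase s) = ρ.erase s := by
      rw [Finset.erase_right_comm]
      exact Finset.insert_erase (Finset.mem_erase.2 ⟨hrs, hr⟩)
    have h1 := hanti _ r s hrs hr' hs'
    have h2 := sign_anticomm (R := R) hrs hr' hs'
    have h3 := sign_mul_self (R := R) s ((ρ.erase r).erase s)
    have h4 := sign_mul_self (R := R) r ((ρ.erase r).erase s)
    rw [e1, e2] at h1 h2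
    generalize sign R r ((ρ.erase r).erase s) = A at *
    generalize sign R s ((ρ.erase r).erase s) = B at *
    generalize sign R r (ρ.erase r) = P at *
    generalize sign R s (ρ.erase s) = Q at *
    linear_combination -(γ r (ρ.erase r) * P) * h3 + (γ s (ρ.erase s) * Q) * h4
      + B * P * h1 - A * γ s (ρ.erase s) * h2
  -- The equation `b` must satisfy determines `b ρ` from any `s ∈ ρ`, and by `hindep` all choices
  -- agree. No division is needed, so the characteristic is irrelevant.
  have hval : ∀ ρ : Finset ι, ∃ z : R, ∀ s ∈ ρ, z = sign R s (ρ.erase s) * γ s (ρ.erase s) := by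
    intro ρ
    rcases ρ.eq_empty_or_nonempty with rfl | ⟨t, ht⟩
    · exact ⟨0, by simp⟩
    · exact ⟨_, fun s hs => hindep ρ t s ht hs⟩
  choose b hb using hval
  refine ⟨b, fun σ => ?_⟩
  refine MvPolynomial.IsHomogeneous.ext_of_coeff_single ?_ (hc σ) fun s => ?_
  · refine MvPolynomial.IsHomogeneous.sum _ _ _ fun s _ => ?_
    exact (isHomogeneous_sign_mul_X s σ).mul (isHomogeneous_C ι (b (insert s σ)))
  · rw [coeff_diff, ← hγ]
    by_cases hs : s ∈ σ
    · rw [hmem σ s hs s hs]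
      refine Finset.sum_eq_zero fun r hr => ?_
      rw [if_neg, mul_zero]
      have : s ≠ r := by
        rintro rfl
        simp [hs] at hr
      simp [this.symm]
    · rw [Finset.sum_eq_single s]
      · rw [if_pos (by simp), tsub_self, coeff_zero_C,
          hb _ s (Finset.mem_insert_self s σ),
          Finset.erase_insert hs, ← mul_assoc, sign_mul_self, one_mul]
      · intro r _ hr
        rw [if_neg, mul_zero]
        simp [hr]
      · simp [hs]

end Koszul

/-! ### From a linear resolution to Koszul homology. -/

namespace LexsegIdeal

variable {k : Type*} [Field k] {n : ℕ}

/-- The constants in the lifting of a linear-coefficient chain along a linear complex. -/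
theorem exists_constants_of_diff_mem_range {β : ℕ → ℕ}
    (D : ∀ i : ℕ, Matrix (Fin (β i)) (Fin (β (i + 1))) (MvPolynomial (Fin n) k))
    (hD : ∀ i p q, (D i p q).IsHomogeneous 1)
    (hex : ∀ i, Function.Exact (D (i + 1)).mulVecLin (D i).mulVecLin) (N : ℕ) :
    ∀ (i : ℕ) (c : Finset (Fin n) → Fin (β i) → MvPolynomial (Fin n) k),
      (∀ σ p, (c σ p).IsHomogeneous 1) → (∀ σ, N ≤ σ.card → c σ = 0) →
      (∀ σ, Koszul.diff (X : Fin n → MvPolynomial (Fin n) k) c σ ∈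
        LinearMap.range (D i).mulVecLin) →
      ∃ (b : Finset (Fin n) → Fin (β i) → k) (e : Finset (Fin n) → Fin (β (i + 1)) → k),
        ∀ σ, c σ = Koszul.diff (X : Fin n → MvPolynomial (Fin n) k) (fun τ p => C (b τ p)) σ
          + (D i).mulVecLin fun q => C (e σ q) := by
  induction N with
  | zero =>
    intro i c _ hc _
    refine ⟨0, 0, fun σ => ?_⟩
    rw [hc σ (Nat.zero_le _)]
    ext p : 1
    simp [Koszul.diff, Matrix.mulVec, dotProduct]
  | succ N ih =>
    intro i c hc1 hcN hc
    -- A zigzag through the double complex of Koszul chains and resolution steps. The lift has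
    -- linear entries by degree, and its support loses one cardinality because `diff` does; this
    -- drives the induction.
    have hlift : ∀ σ, ∃ c' : Fin (β (i + 1)) → MvPolynomial (Fin n) k,
        (∀ q, (c' q).IsHomogeneous 1) ∧ (N ≤ σ.card → c' = 0) ∧
        (D i).mulVecLin c' = Koszul.diff (X : Fin n → MvPolynomial (Fin n) k) c σ := by
      intro σ
      by_cases hσ : N ≤ σ.card
      · refine ⟨0, fun q => isHomogeneous_zero _ _ _, fun _ => rfl, ?_⟩
        rw [map_zero, Koszul.diff_eq_zero_of_card hcN σ hσ]
      · obtain ⟨y, hy⟩ := hc σ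
        refine ⟨fun q => homogeneousComponent 1 (y q),
          fun q => homogeneousComponent_isHomogeneous _ _, fun h => absurd h hσ, ?_⟩
        rw [← hy]
        ext p : 1
        have hdeg : ((D i).mulVecLin y p).IsHomogeneous (1 + 1) := by
          rw [hy]
          simp only [Koszul.diff, Finset.sum_apply, Pi.smul_apply, smul_eq_mul]
          refine IsHomogeneous.sum _ _ _ fun s _ => ?_
          exact (Koszul.isHomogeneous_sign_mul_X s σ).mul (hc1 _ _)
        have h2 := homogeneousComponent_eq_self hdeg
        rw [← h2]
        simp only [Matrix.mulVecLin_apply, Matrix.mulVec, dotProduct, map_sum]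
        exact Finset.sum_congr rfl fun q _ => ((hD i p q).homogeneousComponent_mul 1 _).symm
    choose c' hc'1 hc'N hc' using hlift
    obtain ⟨b', e', hbe⟩ := ih (i + 1) c' hc'1 (fun σ => hc'N σ) (by
      intro σ
      refine (hex i _).1 ?_
      rw [Koszul.map_diff]
      simp only [hc']
      exact Koszul.diff_diff _ _ σ)
    -- Since consecutive maps `D` compose to zero, `g` has the same boundary as `c`, so `c - g` is a
    -- cycle of linear forms in a free module.
    let g : Finset (Fin n) → Fin (β i) → MvPolynomial (Fin n) k :=
      fun σ => (D i).mulVecLin fun q => C (b' σ q)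
    have hcycle : ∀ σ, Koszul.diff (X : Fin n → MvPolynomial (Fin n) k)
        (fun τ => c τ - g τ) σ = 0 := by
      intro σ
      rw [Koszul.diff_sub, ← hc' σ, hbe σ, map_add, Koszul.map_diff, (hex i _).2 ⟨_, rfl⟩]
      simp [g]
    have hlin : ∀ p, ∃ b : Finset (Fin n) → k, ∀ σ,
        Koszul.diff (X : Fin n → MvPolynomial (Fin n) k) (fun τ => C (b τ)) σ
          = c σ p - g σ p := by
      intro p
      refine Koszul.exists_constant_of_diff_eq_zero (fun σ => (hc1 σ p).sub ?_) fun σ => ?_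
      · refine IsHomogeneous.sum _ _ _ fun q _ => ?_
        simpa using (hD i p q).mul (isHomogeneous_C (Fin n) (b' σ q))
      · have := congrFun (hcycle σ) p
        simpa [Koszul.diff] using this
    choose b hb using hlin
    refine ⟨fun σ p => b p σ, b', fun σ => ?_⟩
    ext p : 1
    have h1 := hb p σ
    have h2 : Koszul.diff (X : Fin n → MvPolynomial (Fin n) k)
          (fun τ p => (C (b p τ) : MvPolynomial (Fin n) k)) σ p
        = Koszul.diff (X : Fin n → MvPolynomial (Fin n) k) (fun τ => C (b p τ)) σ := by
      simp [Koszul.diff]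
    rw [Pi.add_apply, h2, h1]
    simp [g]

/-- If `I` has a `d`-linear resolution, then the Koszul homology of `I` vanishes in the degrees next
to the linear strand. -/
theorem HasLinearResolution.exists_diff_eq {d : ℕ} {I : Ideal (MvPolynomial (Fin n) k)}
    (hI : HasLinearResolution d I) {c : Finset (Fin n) → MvPolynomial (Fin n) k}
    (hcI : ∀ σ, c σ ∈ I) (hcd : ∀ σ, (c σ).IsHomogeneous (d + 1))
    (hc : ∀ σ, Koszul.diff (X : Fin n → MvPolynomial (Fin n) k) c σ = 0) :
    ∃ b : Finset (Fin n) → MvPolynomial (Fin n) k, (∀ σ, b σ ∈ I) ∧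
      ∀ σ, Koszul.diff (X : Fin n → MvPolynomial (Fin n) k) b σ = c σ := by
  obtain ⟨β, f, D, hf, hspan, hD, hex0, hex⟩ := hI
  let F := Fintype.linearCombination (MvPolynomial (Fin n) k) f
  have hlift : ∀ σ, ∃ c' : Fin (β 0) → MvPolynomial (Fin n) k,
      (∀ q, (c' q).IsHomogeneous 1) ∧ F c' = c σ := by
    intro σ
    have h1 := hcI σ
    rw [← hspan] at h1
    obtain ⟨y, hy⟩ := Ideal.mem_span_range_iff_exists_fun.1 h1
    refine ⟨fun q => homogeneousComponent 1 (y q),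
      fun q => homogeneousComponent_isHomogeneous _ _, ?_⟩
    rw [← homogeneousComponent_eq_self (hcd σ), ← hy]
    simp only [F, Fintype.linearCombination_apply, map_sum, smul_eq_mul]
    refine Finset.sum_congr rfl fun q _ => ?_
    rw [mul_comm, ← (hf q).homogeneousComponent_mul 1, mul_comm]
  choose c' hc'1 hc' using hlift
  -- No subset of `Fin n` has `n + 1` elements, so the bound holds for every chain.
  obtain ⟨b, e, hbe⟩ := exists_constants_of_diff_mem_range D hD hex (n + 1) 0 c' hc'1
    (fun σ hσ => by
      have := Finset.card_le_univ σ
      rw [Fintype.card_fin] at this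
      omega)
    (fun σ => by
      refine (hex0 _).1 ?_
      rw [Koszul.map_diff]
      change Koszul.diff X (fun τ => F (c' τ)) σ = 0
      simp only [hc']
      exact hc σ)
  refine ⟨fun σ => F fun p => C (b σ p), fun σ => ?_, fun σ => ?_⟩
  · rw [← hspan]
    exact Ideal.mem_span_range_iff_exists_fun.2 ⟨_, rfl⟩
  · rw [← Koszul.map_diff, ← hc' σ, hbe σ, map_add]
    exact (add_eq_left.2 ((hex0 _).2 ⟨_, rfl⟩)).symm

theorem monomial_mem_monomialIdeal {T : Set (Fin n →₀ ℕ)} {m : Fin n →₀ ℕ} :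
    monomial m (1 : k) ∈ monomialIdeal k T ↔ ∃ t ∈ T, t ≤ m := by
  rw [monomialIdeal, mem_ideal_span_monomial_image]
  simp

/-- A vanishing Koszul homology class, read off on monomials. -/
theorem HasLinearResolution.single_add_mem [NeZero n] {d : ℕ} {T : Set (Fin n →₀ ℕ)}
    (hT : ∀ t ∈ T, t.degree = d) (hI : HasLinearResolution d (monomialIdeal k T))
    {q : Fin n →₀ ℕ} (hq : q.degree + 1 = d) (hqT : Finsupp.single 0 1 + q ∉ T)
    (h : ∀ j ≠ 0, ∃ t ∈ T, t ≤ Finsupp.single 0 1 + q + Finsupp.single j 1)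
    {i : Fin n} (hi : i ≠ 0) : Finsupp.single i 1 + q ∈ T := by
  classical
  have heq : ∀ {t m : Fin n →₀ ℕ}, t ∈ T → t ≤ m → m.degree = d → t = m := by
    intro t m ht htm hm
    obtain ⟨c, rfl⟩ := exists_add_of_le htm
    rw [map_add, hT t ht] at hm
    rw [(Finsupp.degree_eq_zero_iff c).1 (by omega), add_zero]
  set P : Fin n →₀ ℕ := Finsupp.single 0 1 + q with hP
  have hPd : P.degree = d := by
    rw [hP, map_add, Finsupp.degree_single]
    omega
  let τ : Finset (Fin n) := Finset.univ.erase 0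
  -- `P e_τ` is not a chain over `I`, but every coefficient of its boundary is `0` or `± x_s P` with
  -- `s ≠ 0`, which `h` puts in `I`.
  let B : Finset (Fin n) → MvPolynomial (Fin n) k := Pi.single τ (monomial P 1)
  have hterm : ∀ σ : Finset (Fin n), ∀ s ∈ σᶜ,
      (Koszul.sign (MvPolynomial (Fin n) k) s σ * X s) • B (insert s σ) = 0 ∨
      (s ≠ 0 ∧ (Koszul.sign (MvPolynomial (Fin n) k) s σ * X s) • B (insert s σ) =
        C (Koszul.sign k s σ) * monomial (P + Finsupp.single s 1) 1) := by
    intro σ s _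
    by_cases hs : insert s σ = τ
    · refine Or.inr ⟨?_, ?_⟩
      · have : s ∈ τ := hs ▸ Finset.mem_insert_self s σ
        simpa [τ] using this
      · simp only [B, hs, Pi.single_eq_same, Koszul.sign_eq_C, smul_eq_mul, mul_assoc, X, monomial_mul,
          one_mul, add_comm P]
    · left
      simp [B, hs]
  obtain ⟨b, hbI, hb⟩ := hI.exists_diff_eq
    (c := Koszul.diff (X : Fin n → MvPolynomial (Fin n) k) B)
    (fun σ => by
      refine Ideal.sum_mem _ fun s hs => ?_
      rcases hterm σ s hs with h0 | ⟨hs0, h1⟩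
      · rw [h0]
        exact Ideal.zero_mem _
      · rw [h1]
        exact Ideal.mul_mem_left _ _ (monomial_mem_monomialIdeal.2 (h s hs0)))
    (fun σ => by
      refine IsHomogeneous.sum _ _ _ fun s hs => ?_
      rcases hterm σ s hs with h0 | ⟨hs0, h1⟩
      · rw [h0]
        exact isHomogeneous_zero _ _ _
      · rw [h1]
        have := (isHomogeneous_C (Fin n) (Koszul.sign k s σ)).mul
          (isHomogeneous_monomial (1 : k) (d := P + Finsupp.single s 1) (n := d + 1)
            (by rw [map_add, hPd, Finsupp.degree_single]))
        simpa using this)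
    (fun σ => Koszul.diff_diff _ _ σ)
  by_contra hcon
  have hbc : ∀ σ m, m.degree = d → m ∉ T → coeff m (b σ) = 0 := by
    intro σ m hm hmT
    by_contra h0
    obtain ⟨t, ht, htm⟩ := mem_ideal_span_monomial_image.1 (hbI σ) m (mem_support_iff.2 h0)
    exact hmT (heq ht htm hm ▸ ht)
  -- At `τ \ {i}` the coefficient of `x_i P` is `± 1` in the boundary of `B`. In that of `b` it
  -- comes only from the coefficients of `P` (inserting `i`) and of `x_i q` (inserting `0`), both
  -- zero if neither monomial is in `T`.
  have hc := congrArg (coeff (P + Finsupp.single i 1)) (hb (τ.erase i))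
  have hiτ : i ∈ τ := by simp [τ, hi]
  rw [Koszul.coeff_diff, Koszul.coeff_diff, Finset.sum_eq_zero,
    Finset.sum_eq_single_of_mem i (by simp)] at hc
  · rw [if_pos (by simp), add_tsub_cancel_right, Finset.insert_erase hiτ] at hc
    simp only [B, Pi.single_eq_same, coeff_monomial, if_true, mul_one] at hc
    have := Koszul.sign_mul_self (R := k) i (τ.erase i)
    rw [← hc] at this
    simp at this
  · intro s _ hsi
    have : insert s (τ.erase i) ≠ τ := by
      intro hs
      have hi' := hiτ
      rw [← hs] at hi'
      simp [hsi.symm] at hi'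
    simp [B, this]
  · intro s hs
    have hs' : s = i ∨ s = 0 := by
      by_contra hne
      push Not at hne
      simp [τ, hne.1, hne.2] at hs
    rcases hs' with rfl | rfl
    · rw [add_tsub_cancel_right, hbc _ _ hPd hqT]
      simp
    · rw [hP, add_assoc, add_tsub_cancel_left, add_comm q, hbc _ _ _ hcon]
      · simp
      · rw [map_add, Finsupp.degree_single]
        omega

end LexsegIdeal

/-! ### Exchange properties of lexsegments. -/

namespace LexsegIdeal

section Exchange

variable {n : ℕ}

theorem toLex_lt_iff_of_add_single_eq {a b : Fin n →₀ ℕ} {s i : Fin n}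
    (h : a + Finsupp.single s 1 = b + Finsupp.single i 1) : toLex b < toLex a ↔ i < s := by
  rw [← add_lt_add_iff_right (toLex (Finsupp.single s 1)), ← toLex_add, ← toLex_add, h, toLex_add,
    toLex_add, add_lt_add_iff_left, Finsupp.Lex.single_lt_iff]

theorem toLex_le_of_add_single_eq {a b : Fin n →₀ ℕ} {s i : Fin n}
    (h : a + Finsupp.single s 1 = b + Finsupp.single i 1) (hs : s ≤ i) : toLex a ≤ toLex b :=
  not_lt.1 fun h' => ((toLex_lt_iff_of_add_single_eq h).1 h').not_ge hs

theorem exists_eq_add_single {m : Fin n →₀ ℕ} {i : Fin n} (h : m i ≠ 0) :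
    ∃ c, m = c + Finsupp.single i 1 := by
  have hle : Finsupp.single i 1 ≤ m := by
    rw [Finsupp.single_le_iff]
    exact Nat.one_le_iff_ne_zero.2 h
  exact ⟨m - Finsupp.single i 1, (tsub_add_cancel_of_le hle).symm⟩

theorem degree_add_single (c : Fin n →₀ ℕ) (i : Fin n) :
    (c + Finsupp.single i 1).degree = c.degree + 1 := by
  rw [map_add, Finsupp.degree_single]

theorem exists_add_single_eq_of_le {a b : Fin n →₀ ℕ} {i : Fin n} (hdeg : a.degree = b.degree)
    (h : a ≤ b + Finsupp.single i 1) :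
    ∃ s, a + Finsupp.single s 1 = b + Finsupp.single i 1 := by
  obtain ⟨c, hc⟩ := exists_add_of_le h
  have hc1 : c.degree = 1 := by
    have := congrArg Finsupp.degree hc
    rw [degree_add_single, map_add] at this
    omega
  have hne : c ≠ 0 := by
    rintro rfl
    simp at hc1
  obtain ⟨s, hs⟩ := Finsupp.support_nonempty_iff.2 hne
  obtain ⟨c', rfl⟩ := exists_eq_add_single (Finsupp.mem_support_iff.1 hs)
  rw [degree_add_single] at hc1
  rw [(Finsupp.degree_eq_zero_iff c').1 (by omega), zero_add] at hc
  exact ⟨s, hc.symm⟩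

theorem exists_lt_of_degree_eq {a b : Fin n →₀ ℕ} (hdeg : a.degree = b.degree) {i : Fin n}
    (hi : a i < b i) : ∃ j, b j < a j := by
  by_contra! hcon
  rw [Finsupp.degree_eq_sum, Finsupp.degree_eq_sum] at hdeg
  exact (Finset.sum_lt_sum (fun j _ => hcon j) ⟨i, Finset.mem_univ i, hi⟩).ne hdeg

theorem exists_gt_lt_of_degree_eq {a b : Fin n →₀ ℕ} (hdeg : a.degree = b.degree)
    (hab : toLex a < toLex b) :
    ∃ i j, (∀ l < i, a l = b l) ∧ a i < b i ∧ i < j ∧ b j < a j := by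
  obtain ⟨i, hi, hlt⟩ := Finsupp.Lex.lt_iff.1 hab
  obtain ⟨j, hj⟩ := exists_lt_of_degree_eq hdeg hlt
  refine ⟨i, j, hi, hlt, ?_, hj⟩
  by_contra! hji
  rcases hji.lt_or_eq with h | rfl
  · exact hj.ne' (hi j h)
  · exact lt_asymm hj hlt

theorem mem_lexsegment_of_le_of_le {d : ℕ} {u v x y z : Fin n →₀ ℕ} (hx : x ∈ lexsegment d u v)
    (hz : z ∈ lexsegment d u v) (hy : y.degree = d) (hzy : toLex z ≤ toLex y)
    (hyx : toLex y ≤ toLex x) : y ∈ lexsegment d u v :=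
  ⟨hy, hyx.trans hx.2.1, hz.2.2.trans hzy⟩

variable [NeZero n]

theorem zero_le_of_toLex_le {a b : Fin n →₀ ℕ} (h : toLex a ≤ toLex b) : a 0 ≤ b 0 := by
  by_contra! hlt
  refine h.not_gt (Finsupp.Lex.lt_iff.2 ⟨0, fun j hj => ?_, hlt⟩)
  exact absurd hj (Fin.zero_le j).not_gt

theorem toLex_lt_of_zero_lt {a b : Fin n →₀ ℕ} (h : a 0 < b 0) : toLex a < toLex b :=
  not_le.1 fun h' => (zero_le_of_toLex_le h').not_gt h

/-- Replacing a variable by a larger one other than the first leads to another generator, unless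
replacing the first variable does. -/
def IsExchangeable (T : Set (Fin n →₀ ℕ)) : Prop :=
  ∀ m ∈ T, ∀ i j : Fin n, i ≠ 0 → i < j → m j ≠ 0 →
    ∃ m' ∈ T, m' + Finsupp.single j 1 = m + Finsupp.single i 1 ∨
      m' + Finsupp.single 0 1 = m + Finsupp.single i 1

theorem isExchangeable_lexsegment {k : Type*} [Field k] {d : ℕ} {u v : Fin n →₀ ℕ}
    (hu : u.degree = d) (hv : v.degree = d) (huv : LexGE u v)
    (hcomplete : IsCompletelyLexsegment (lexsegment d u v))
    (hlinear : HasLinearResolution d (monomialIdeal k (lexsegment d u v))) :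
    IsExchangeable (lexsegment d u v) := by
  intro m hm i j hi hij hmj
  have hj : j ≠ 0 := ((Fin.zero_le i).trans_lt hij).ne'
  obtain ⟨c, rfl⟩ := exists_eq_add_single hmj
  set Y := c + Finsupp.single i 1 with hY
  have hYm : Y + Finsupp.single j 1 = c + Finsupp.single j 1 + Finsupp.single i 1 := by
    rw [hY]
    abel
  have hcd : c.degree + 1 = d := by
    rw [← hm.1, degree_add_single]
  have hYd : Y.degree = d := by rw [hY, degree_add_single, hcd]
  have hmY : toLex (c + Finsupp.single j 1) < toLex Y := (toLex_lt_iff_of_add_single_eq hYm).2 hij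
  have hvY : toLex v ≤ toLex Y := hm.2.2.trans hmY.le
  by_cases hYu : toLex Y ≤ toLex u
  · exact ⟨Y, ⟨hYd, hYu, hvY⟩, Or.inl hYm⟩
  have hYT : Y ∉ lexsegment d u v := fun h => hYu h.2.1
  have hY0 : Y 0 = c 0 := by simp [hY, hi]
  -- `x_l Y` lies between `x_l v` and `x_0 u`, both in the shadow, and the shadow is a lexsegment.
  have hshadow : ∀ l ≠ 0, ∃ t ∈ lexsegment d u v, ∃ r,
      Y + Finsupp.single l 1 = t + Finsupp.single r 1 := by
    intro l hl
    obtain ⟨e, u', v', -, -, -, he⟩ := hcomplete 1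
    rw [Function.iterate_one] at he
    have h1 : u + Finsupp.single 0 1 ∈ shadow (lexsegment d u v) :=
      ⟨u, ⟨hu, le_refl _, huv⟩, 0, rfl⟩
    have h2 : v + Finsupp.single l 1 ∈ shadow (lexsegment d u v) :=
      ⟨v, ⟨hv, huv, le_refl _⟩, l, rfl⟩
    suffices h3 : Y + Finsupp.single l 1 ∈ shadow (lexsegment d u v) from h3
    rw [he] at h1 h2 ⊢
    refine mem_lexsegment_of_le_of_le h1 h2 ?_ ?_ ?_
    · rw [← h1.1, degree_add_single Y, degree_add_single u, hYd, hu]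
    · rw [toLex_add, toLex_add]
      exact add_le_add_left hvY _
    · refine (toLex_lt_of_zero_lt ?_).le
      have := zero_le_of_toLex_le hm.2.1
      simp only [Finsupp.add_apply, Finsupp.single_apply, hj, hl, if_false, if_true] at this ⊢
      omega
  -- Without `x_0` in `Y`, an equation `x_1 Y = x_r t` has `r ≥ 1`, whence `Y ≤ t ≤ u`.
  by_cases hc0 : c 0 = 0
  · have hn : 1 < n := by
      have := i.isLt
      have : (i : ℕ) ≠ 0 := fun h => hi (Fin.ext (by simpa using h))
      omega
    have h10 : (⟨1, hn⟩ : Fin n) ≠ 0 := fun h => by simpa using congrArg Fin.val h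
    obtain ⟨t, ht, r, htr⟩ := hshadow ⟨1, hn⟩ h10
    have hr : r ≠ 0 := by
      rintro rfl
      have := DFunLike.congr_fun htr 0
      simp [hY0, hc0] at this
    have hr1 : (⟨1, hn⟩ : Fin n) ≤ r := by
      have : (r : ℕ) ≠ 0 := fun h => hr (Fin.ext (by simpa using h))
      exact Fin.mk_le_of_le_val (by omega)
    exact absurd ((toLex_le_of_add_single_eq htr hr1).trans ht.2.1) hYu
  · obtain ⟨q, rfl⟩ := exists_eq_add_single hc0
    have hYq : Y = Finsupp.single 0 1 + (q + Finsupp.single i 1) := by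
      rw [hY]
      abel
    refine ⟨Finsupp.single j 1 + (q + Finsupp.single i 1),
      hlinear.single_add_mem (fun t ht => ht.1) ?_ (hYq ▸ hYT) (fun l hl => ?_) hj, Or.inr ?_⟩
    · rw [degree_add_single, ← hcd, degree_add_single]
    · obtain ⟨t, ht, r, htr⟩ := hshadow l hl
      exact ⟨t, ht, by rw [← hYq, htr]; exact le_self_add⟩
    · abel

/-- The set of the indices `i` for which `x_i m` is a multiple of a generator preceding `m`. -/
def exchangeSet (T : Set (Fin n →₀ ℕ)) (m : Fin n →₀ ℕ) : Set (Fin n) :=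
  {i | i ≠ 0 ∧ ∃ m' ∈ T, ∃ s, (s = 0 ∨ i < s) ∧
    m' + Finsupp.single s 1 = m + Finsupp.single i 1}

theorem IsExchangeable.mem_exchangeSet {T : Set (Fin n →₀ ℕ)} (hT : IsExchangeable T)
    {m : Fin n →₀ ℕ} (hm : m ∈ T) {i j : Fin n} (hi : i ≠ 0) (hij : i < j) (hj : m j ≠ 0) :
    i ∈ exchangeSet T m := by
  obtain ⟨m', hm', h | h⟩ := hT m hm i j hi hij hj
  · exact ⟨hi, m', hm', j, Or.inr hij, h⟩
  · exact ⟨hi, m', hm', 0, Or.inl rfl, h⟩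

/-- For equal degrees, `m' ∣ x_i m` means `x_s m' = x_i m` for some `s`; then `m' ≺ m` says `i ≠ 0`
and either `s = 0` or `i < s`. The index 0 is excluded because it cannot lower the exponent of
`x_0`. -/
theorem mem_exchangeSet_iff {T : Set (Fin n →₀ ℕ)} {d : ℕ} (hT : ∀ t ∈ T, t.degree = d)
    {m : Fin n →₀ ℕ} (hm : m.degree = d) {i : Fin n} :
    i ∈ exchangeSet T m ↔ ∃ m' ∈ T, Prec m' m ∧ m' ≤ m + Finsupp.single i 1 := by
  constructor
  · rintro ⟨hi, m', hm', s, hs, h⟩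
    refine ⟨m', hm', ?_, h ▸ le_self_add⟩
    have h0 := DFunLike.congr_fun h 0
    by_cases hs0 : s = 0
    · left
      subst hs0
      simp [hi] at h0
      omega
    · right
      refine ⟨by simpa [hi, hs0] using h0, ?_⟩
      exact (toLex_lt_iff_of_add_single_eq h).2 (hs.resolve_left hs0)
  · rintro ⟨m', hm', hprec, hle⟩
    obtain ⟨s, hs⟩ := exists_add_single_eq_of_le ((hT m' hm').trans hm.symm) hle
    have h0 := DFunLike.congr_fun hs 0
    simp only [Finsupp.add_apply, Finsupp.single_apply] at h0
    have hi : i ≠ 0 := by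
      rintro rfl
      by_cases hs0 : s = 0
      · subst hs0
        rw [add_right_cancel hs] at hprec
        rcases hprec with h | ⟨-, h⟩ <;> exact lt_irrefl _ h
      · simp only [hs0, if_true, if_false] at h0
        rcases hprec with h | ⟨h, -⟩ <;> omega
    refine ⟨hi, m', hm', s, ?_, hs⟩
    by_cases hs0 : s = 0
    · exact Or.inl hs0
    · right
      simp only [hi, hs0, if_false] at h0
      rcases hprec with h | ⟨-, h⟩
      · omega
      · exact (toLex_lt_iff_of_add_single_eq hs).1 h

/-- This is the linear quotient condition: the variable `x_i` divides `m' / gcd(m', m)` and lies in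
the colon ideal at `m`. -/
theorem exists_mem_exchangeSet {d : ℕ} {u v : Fin n →₀ ℕ}
    (hT : IsExchangeable (lexsegment d u v)) {m m' : Fin n →₀ ℕ} (hm : m ∈ lexsegment d u v)
    (hm' : m' ∈ lexsegment d u v) (hprec : Prec m' m) :
    ∃ i ∈ exchangeSet (lexsegment d u v) m, m i < m' i := by
  have hdeg : m.degree = m'.degree := hm.1.trans hm'.1.symm
  rcases hprec with h0 | ⟨h0, hlex⟩
  · by_contra! hcon
    obtain ⟨i, hi⟩ := exists_lt_of_degree_eq hdeg.symm h0
    have hzero : ∀ i, m i < m' i → i ≠ 0 := by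
      rintro i hi rfl
      omega
    have hmax : ∀ i, m i < m' i → ∀ j, i < j → m j = 0 := by
      intro i hi j hij
      by_contra hj
      exact (hcon i (hT.mem_exchangeSet hm (hzero i hi) hij hj)).not_gt hi
    obtain ⟨c, rfl⟩ := exists_eq_add_single (m := m) (i := 0) (by omega)
    have hXm : c + Finsupp.single i 1 + Finsupp.single 0 1
        = c + Finsupp.single 0 1 + Finsupp.single i 1 := by abel
    have hXd : (c + Finsupp.single i 1).degree = d := by
      rw [← hm.1, degree_add_single, degree_add_single]
    have hi0 := hzero i hi
    refine (hcon i ⟨hi0, c + Finsupp.single i 1, ?_, 0, Or.inl rfl, hXm⟩).not_gt hi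
    refine mem_lexsegment_of_le_of_le hm hm' hXd ?_ (toLex_le_of_add_single_eq hXm (Fin.zero_le i))
    -- If `X = x_i m / x_0 < m'`, the first difference `l` has `m_l < m'_l`, so `m` has no variable
    -- beyond `x_l`. An excess of `X` over `m'` at some `j > l` then forces `j = i`, yet `X_i = m_i
    -- + 1 ≤ m'_i`.
    by_contra! hlt
    obtain ⟨l, j, -, hl, hlj, hj⟩ := exists_gt_lt_of_degree_eq (hXd.trans hm'.1.symm) hlt
    have hj0 : j ≠ 0 := ((Fin.zero_le l).trans_lt hlj).ne'
    simp only [Finsupp.add_apply, Finsupp.single_apply, hi0.symm, if_true,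
      if_false] at hi h0 hl hj hmax
    have hl' : l ≠ 0 := by
      rintro rfl
      simp only [hi0, if_false] at hl
      omega
    have h1 := hmax i (by simpa [hi0.symm] using hi) j
    have h2 := hmax l
    simp only [hl'.symm, hj0.symm, if_false] at h1 h2
    by_cases hij : i = j
    · subst hij
      simp only [if_true] at hj
      omega
    · simp only [hij, if_false] at hj
      by_cases hil : i = l
      · subst hil
        have := h1 hlj
        omega
      · simp only [hil, if_false] at hl
        have := h2 hl j hlj
        simp only [hj0.symm, if_false] at this
        omega
  · obtain ⟨i, j, hl, hi, hij, hj⟩ := exists_gt_lt_of_degree_eq hdeg hlex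
    refine ⟨i, hT.mem_exchangeSet hm ?_ hij (by omega), hi⟩
    rintro rfl
    omega

theorem exchangeSet_subset {d : ℕ} {u v : Fin n →₀ ℕ}
    (hT : IsExchangeable (lexsegment d u v)) {m g : Fin n →₀ ℕ} (hm : m ∈ lexsegment d u v)
    (hg : g ∈ lexsegment d u v) {s : Fin n} (hs : s ∈ exchangeSet (lexsegment d u v) m)
    (hgm : g ≤ m + Finsupp.single s 1)
    (hmin : ∀ m' ∈ lexsegment d u v, m' ≤ m + Finsupp.single s 1 → ¬ Prec m' g) :
    exchangeSet (lexsegment d u v) g ⊆ exchangeSet (lexsegment d u v) m := by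
  obtain ⟨hs0, m₁, hm₁, s₁, hs₁, hms₁⟩ := hs
  obtain ⟨t, hgt⟩ := exists_add_single_eq_of_le (hg.1.trans hm.1.symm) hgm
  rintro i ⟨hi, g', hg', r, hr, hgr⟩
  have hgr0 : i < r → g r ≠ 0 := by
    intro hir h
    have := DFunLike.congr_fun hgr r
    simp [h, hir.ne'] at this
  by_cases ht : t = 0
  · subst ht
    have hm0 : m 0 ≠ 0 := by
      intro h
      have := DFunLike.congr_fun hgt 0
      simp [h, hs0] at this
    obtain ⟨c, rfl⟩ := exists_eq_add_single hm0
    have hgc : g = c + Finsupp.single s 1 := by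
      apply add_right_cancel (b := Finsupp.single (0 : Fin n) 1)
      rw [hgt]
      abel
    subst hgc
    have hym : c + Finsupp.single i 1 + Finsupp.single 0 1
        = c + Finsupp.single 0 1 + Finsupp.single i 1 := by abel
    have hyd : (c + Finsupp.single i 1).degree = d := by
      rw [← hm.1, degree_add_single, degree_add_single]
    have hle := toLex_le_of_add_single_eq hym (Fin.zero_le i)
    rcases hr with rfl | hir
    · refine ⟨hi, _, mem_lexsegment_of_le_of_le hm hg' hyd ?_ hle, 0, Or.inl rfl, hym⟩
      refine toLex_le_of_add_single_eq (s := 0) (i := s) ?_ (Fin.zero_le s)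
      rw [hgr]
      abel
    · by_cases hmr : (c + Finsupp.single 0 1 : Fin n →₀ ℕ) r = 0
      · have hrs : s = r := by
          by_contra hne
          have h1 := hgr0 hir
          simp only [Finsupp.add_apply, Finsupp.single_apply, hne, if_false] at h1 hmr
          omega
        subst hrs
        refine ⟨hi, _, mem_lexsegment_of_le_of_le hm hg hyd ?_ hle, 0, Or.inl rfl, hym⟩
        refine toLex_le_of_add_single_eq (s := i) (i := s) ?_ hir.le
        abel
      · exact hT.mem_exchangeSet hm hi hir hmr
  · have hg0 : g 0 = m 0 := by simpa [ht, hs0] using DFunLike.congr_fun hgt 0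
    -- With `t ≠ 0`, minimality of `g` rules out `x_s m / x_0 ∈ T`, so every exchange that brings in
    -- `x_s` must trade away a later variable.
    have hnot : ∀ y ∈ lexsegment d u v, y + Finsupp.single 0 1 ≠ m + Finsupp.single s 1 := by
      intro y hy h
      refine hmin y hy (h ▸ le_self_add) (Or.inl ?_)
      have := DFunLike.congr_fun h 0
      simp [hs0] at this
      omega
    have hs₁0 : s₁ ≠ 0 := by
      rintro rfl
      exact hnot m₁ hm₁ hms₁
    have hss₁ : s < s₁ := hs₁.resolve_left hs₁0
    have hms : s₁ ∈ m.support := by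
      rw [Finsupp.mem_support_iff]
      intro h
      have := DFunLike.congr_fun hms₁ s₁
      simp [h, hss₁.ne'] at this
    let M := m.support.max' ⟨s₁, hms⟩
    have hM : m M ≠ 0 := Finsupp.mem_support_iff.1 (m.support.max'_mem _)
    have hsM : s < M := hss₁.trans_le (m.support.le_max' s₁ hms)
    have hmax : ∀ l, m l ≠ 0 → l ≤ M := fun l hl =>
      m.support.le_max' l (Finsupp.mem_support_iff.2 hl)
    have hM0 : M ≠ 0 := ((Fin.zero_le s).trans_lt hsM).ne'
    obtain ⟨y, hy, hyM | hy0⟩ := hT m hm s M hs0 hsM hM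
    swap
    · exact absurd hy0 (hnot y hy)
    -- Minimality makes `g` the lex-largest choice, so the last variable `x_M` of `m` is the one
    -- traded: `g = x_s m / x_M`.
    have htM : t = M := by
      have h1 : M ≤ t := by
        by_contra! hlt
        refine hmin y hy (hyM ▸ le_self_add) (Or.inr ⟨?_, ?_⟩)
        · rw [hg0]
          simpa [hM0, hs0] using DFunLike.congr_fun hyM 0
        · exact (toLex_lt_iff_of_add_single_eq (hyM.trans hgt.symm)).2 hlt
      refine le_antisymm (hmax t fun h => ?_) h1
      have := DFunLike.congr_fun hgt t
      simp [h, (hsM.trans_le h1).ne'] at this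
    rw [htM] at hgt
    by_cases hiM : i < M
    · exact hT.mem_exchangeSet hm hi hiM hM
    rcases hr with rfl | hir
    -- With `i ≥ M`, `g' = x_i g / x_0 ≤ x_s m / x_0 ≤ m`, so convexity would put `x_s m / x_0` in
    -- `T`.
    · exfalso
      have hm0 : m 0 ≠ 0 := by
        rw [← hg0]
        intro h
        have := DFunLike.congr_fun hgr 0
        simp [h, hi] at this
      obtain ⟨c, rfl⟩ := exists_eq_add_single hm0
      have hym : c + Finsupp.single s 1 + Finsupp.single 0 1
          = c + Finsupp.single 0 1 + Finsupp.single s 1 := by abel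
      refine hnot (c + Finsupp.single s 1) (mem_lexsegment_of_le_of_le hm hg' ?_ ?_
        (toLex_le_of_add_single_eq hym (Fin.zero_le s))) hym
      · rw [← hm.1, degree_add_single, degree_add_single]
      · refine toLex_le_of_add_single_eq (s := M) (i := i) ?_ (not_lt.1 hiM)
        apply add_right_cancel (b := Finsupp.single (0 : Fin n) 1)
        rw [add_right_comm, hgr, add_right_comm, hgt]
        abel
    · refine absurd (hmax r fun h => ?_) ((not_lt.1 hiM).trans_lt hir).not_ge
      have := DFunLike.congr_fun hgt r
      have h1 := hgr0 hir
      have h2 : s ≠ r := (hsM.trans_le ((not_lt.1 hiM).trans hir.le)).ne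
      simp only [Finsupp.add_apply, Finsupp.single_apply, h, h2, if_false] at this
      omega

end Exchange

end LexsegIdeal

/-! ### Translation to generators, colon ideals and the decomposition function. -/

namespace LexsegIdeal

theorem minimalGenerators_monomialIdeal {k : Type*} [Field k] {n d : ℕ} {T : Set (Fin n →₀ ℕ)}
    (hT : ∀ t ∈ T, t.degree = d) : minimalGenerators (monomialIdeal k T) = T := by
  have heq : ∀ a ∈ T, ∀ b ∈ T, a ≤ b → a = b := by
    intro a ha b hb hab
    obtain ⟨c, rfl⟩ := exists_add_of_le hab
    have h := hT _ hb
    rw [map_add, hT a ha] at h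
    rw [(Finsupp.degree_eq_zero_iff c).1 (by omega), add_zero]
  ext a
  simp only [minimalGenerators, Set.mem_ofPred_eq]
  constructor
  · intro ha
    obtain ⟨t, ht, hta⟩ := monomial_mem_monomialIdeal.1 ha.1
    rwa [hta.antisymm (ha.2 (monomial_mem_monomialIdeal.2 ⟨t, ht, le_rfl⟩) hta)] at ht
  · refine fun ha => ⟨monomial_mem_monomialIdeal.2 ⟨a, ha, le_rfl⟩, fun b hb hba => ?_⟩
    obtain ⟨t, ht, htb⟩ := monomial_mem_monomialIdeal.1 hb
    rwa [heq t ht a ha (htb.trans hba)] at htb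

section Enumeration

variable {n : ℕ} [NeZero n]

/-- The order `≺` as the order of keys in a linear order. -/
def precKey (a : Fin n →₀ ℕ) : ℕ ×ₗ (Lex (Fin n →₀ ℕ))ᵒᵈ :=
  toLex (a 0, OrderDual.toDual (toLex a))

theorem precKey_lt_iff {a b : Fin n →₀ ℕ} : precKey a < precKey b ↔ Prec a b :=
  Prod.Lex.toLex_lt_toLex

theorem precKey_injective : Function.Injective (precKey (n := n)) := by
  intro a b h
  have h2 := congrArg (fun p => (ofLex p).2) h
  exact toLex.injective (OrderDual.toDual.injective h2)

theorem exists_prec_enumeration {T : Set (Fin n →₀ ℕ)} (hT : T.Finite) :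
    ∃ (r : ℕ) (w : Fin r → (Fin n →₀ ℕ)), (∀ i j, Prec (w i) (w j) ↔ i < j) ∧ Set.range w = T := by
  classical
  let S := hT.toFinset.image precKey
  let e := S.orderEmbOfFin rfl
  have hmem : ∀ i, ∃ a ∈ T, precKey a = e i := by
    intro i
    obtain ⟨a, ha, hai⟩ := Finset.mem_image.1 (S.orderEmbOfFin_mem rfl i)
    exact ⟨a, hT.mem_toFinset.1 ha, hai⟩
  choose w hwT hw using hmem
  refine ⟨S.card, w, fun i j => ?_, ?_⟩
  · rw [← precKey_lt_iff, hw, hw, e.lt_iff_lt]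
  · refine Set.Subset.antisymm (Set.range_subset_iff.2 hwT) fun a ha => ?_
    have h1 : precKey a ∈ Set.range e := by
      rw [Finset.range_orderEmbOfFin]
      simp only [S, Finset.coe_image, Set.Finite.coe_toFinset]
      exact Set.mem_image_of_mem _ ha
    obtain ⟨i, hi⟩ := h1
    exact ⟨i, precKey_injective ((hw i).trans hi)⟩

end Enumeration

section Quotients

variable {k : Type*} [Field k] {n r : ℕ} {w : Fin r → (Fin n →₀ ℕ)}

theorem mem_colonIdeal_iff {j : Fin r} {p : MvPolynomial (Fin n) k} :
    p ∈ colonIdeal k w j ↔ ∀ c ∈ p.support, ∃ l < j, w l ≤ c + w j := by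
  classical
  rw [colonIdeal, Submodule.mem_colon_singleton, smul_eq_mul, monomialIdeal,
    mem_ideal_span_monomial_image]
  constructor
  · intro h c hc
    obtain ⟨-, ⟨l, hl, rfl⟩, hle⟩ := h (c + w j) (by
      rw [mem_support_iff, coeff_mul_monomial, mul_one]
      exact mem_support_iff.1 hc)
    exact ⟨l, hl, hle⟩
  · intro h c hc
    rw [mem_support_iff, coeff_mul_monomial'] at hc
    split_ifs at hc with hle
    · obtain ⟨l, hl, hle'⟩ := h (c - w j) (mem_support_iff.2 (by simpa using hc))
      rw [tsub_add_cancel_of_le hle] at hle'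
      exact ⟨w l, ⟨l, hl, rfl⟩, hle'⟩
    · exact absurd rfl hc

theorem mem_genSet_iff {j : Fin r} {i : Fin n} :
    i ∈ genSet k w j ↔ ∃ l < j, w l ≤ Finsupp.single i 1 + w j := by
  rw [genSet, Set.mem_ofPred_eq, mem_colonIdeal_iff]
  simp [support_X]

/-- A monomial `c` of the colon ideal has `w l ∣ c · w j` for some `l < j`; a variable with larger
exponent in `w l` than in `w j` must divide `c`. -/
theorem hasLinearQuotients_of_exists
    (h : ∀ j, ∀ l < j, ∃ i ∈ genSet k w j, w j i < w l i) : HasLinearQuotients k w := by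
  refine fun j _ => ⟨genSet k w j, le_antisymm (fun p hp => ?_) ?_⟩
  · refine mem_ideal_span_X_image.2 fun c hc => ?_
    obtain ⟨l, hl, hle⟩ := mem_colonIdeal_iff.1 hp c hc
    obtain ⟨i, hi, hlt⟩ := h j l hl
    refine ⟨i, hi, fun h0 => ?_⟩
    have := hle i
    rw [Finsupp.add_apply, h0] at this
    omega
  · rw [Ideal.span_le]
    rintro - ⟨i, hi, rfl⟩
    exact hi

theorem decompositionFunction_spec (a : monomialsOf k w) :
    w (decompositionFunction k w a) ≤ a.1 ∧
      ∀ l, w l ≤ a.1 → decompositionFunction k w a ≤ l := by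
  have hiff : ∀ l, w l ≤ a.1 → decompositionFunction k w a ≤ l := fun l hl =>
    not_lt.1 (WellFounded.not_lt_min (wellFounded_lt (α := Fin r)) (x := l)
      (s := {j : Fin r | monomial a.1 (1 : k) ∈ monomialIdeal k (w '' Set.Iic j)})
      (monomial_mem_monomialIdeal.2 ⟨w l, ⟨l, Set.mem_Iic.2 le_rfl, rfl⟩, hl⟩))
  refine ⟨?_, hiff⟩
  have h := WellFounded.min_mem (wellFounded_lt (α := Fin r)) _
    (exists_mem_of_mem_monomialsOf k w a)
  obtain ⟨-, ⟨l, hl, rfl⟩, hle⟩ := monomial_mem_monomialIdeal.1 h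
  have : l = decompositionFunction k w a := le_antisymm hl (hiff l hle)
  exact this ▸ hle

end Quotients

end LexsegIdeal

theorem theorem1p7 {k : Type*} [Field k] {n : ℕ} [NeZero n] {d : ℕ} (hd : 2 ≤ d)
    (u v : Fin n →₀ ℕ) (hu : u.degree = d) (hv : v.degree = d) (huv : LexsegIdeal.LexGE u v)
    (hcomplete : LexsegIdeal.IsCompletelyLexsegment (LexsegIdeal.lexsegment d u v))
    (hlinear : LexsegIdeal.HasLinearResolution d
      (LexsegIdeal.monomialIdeal k (LexsegIdeal.lexsegment d u v))) :
    ∃ (r : ℕ) (w : Fin r → (Fin n →₀ ℕ)),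
      (∀ i j : Fin r, i < j → LexsegIdeal.Prec (w i) (w j)) ∧
      Set.range w = LexsegIdeal.minimalGenerators
        (LexsegIdeal.monomialIdeal k (LexsegIdeal.lexsegment d u v)) ∧
      LexsegIdeal.HasLinearQuotients k w ∧
      LexsegIdeal.HasRegularDecomposition k w := by
  have hT := LexsegIdeal.isExchangeable_lexsegment hu hv huv hcomplete hlinear
  have hdeg : ∀ t ∈ LexsegIdeal.lexsegment d u v, t.degree = d := fun t ht => ht.1
  obtain ⟨r, w, hw, hrange⟩ := LexsegIdeal.exists_prec_enumeration
    ((Finsupp.finite_of_degree_eq d).subset hdeg)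
  have hwT : ∀ j, w j ∈ LexsegIdeal.lexsegment d u v := fun j => hrange ▸ Set.mem_range_self j
  -- The enumeration is strictly increasing for `≺`, so `l < j` may be read as `w l ≺ w j`, and the
  -- algebraic set becomes the combinatorial one.
  have hset : ∀ j, LexsegIdeal.genSet k w j =
      LexsegIdeal.exchangeSet (LexsegIdeal.lexsegment d u v) (w j) := by
    intro j
    ext i
    rw [LexsegIdeal.mem_genSet_iff, LexsegIdeal.mem_exchangeSet_iff hdeg (hdeg _ (hwT j)),
      ← hrange, Set.exists_range_iff]
    simp only [hw, add_comm (w j)]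
  refine ⟨r, w, fun i j => (hw i j).2, ?_, ?_, fun j s hs => ?_⟩
  · rw [hrange, LexsegIdeal.minimalGenerators_monomialIdeal hdeg]
  · refine LexsegIdeal.hasLinearQuotients_of_exists fun j l hlj => ?_
    rw [hset j]
    exact LexsegIdeal.exists_mem_exchangeSet hT (hwT j) (hwT l) ((hw l j).2 hlj)
  · obtain ⟨hle, hmin⟩ := LexsegIdeal.decompositionFunction_spec (k := k) (w := w)
      ⟨Finsupp.single s 1 + w j, LexsegIdeal.single_add_mem_monomialsOf k w s j⟩
    rw [hset] at hs ⊢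
    rw [hset]
    dsimp only at hle hmin
    have hle := hle.trans_eq (add_comm _ _)
    refine LexsegIdeal.exchangeSet_subset hT (hwT j) (hwT _) hs hle fun m' hm' hm'le hprec => ?_
    rw [← hrange] at hm'
    obtain ⟨l, rfl⟩ := hm'
    rw [add_comm] at hm'le
    exact ((hw _ _).1 hprec).not_ge (hmin l hm'le)
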